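/- Let $k$ be a field of prime characteristic $p$, let $r\ge 0$, and let $$R=\frac{k[t,x,y]}{(f_1,\ldots,f_r)},$$ where $f_1,\ldots,f_r$ are homogeneous polynomials with respect to the grading in which $\deg t=0$ and $\deg x=\deg y=1$. For an ideal $J$ of $R$ and $q=p^e$ let $J^{[q]}$ denote the ideal generated by the $q$th powers of the elements (equivalently, of a set of generators) of $J$, and write $J^{c[q]}=(J^c)^{[q]}$. Let $I=(x,y)\subseteq R$. Then the Frobenius powers of $I$ have linear growth of primary decompositions: there is a number $c\in\mathbb{N}$ such that for each $q=p^e$, $e\ge 0$, there is a primary decomposition $$I^{[q]}=Q_1\cap Q_2\cap\cdots\cap Q_m$$ (with $m$ depending on $q$, and $m=0$ allowed when $I^{[q]}=R$) such that $(\sqrt{Q_i})^{c[q]}\subseteq Q_i$ for all $i=1,\ldots,m$. -/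

import Mathlib

/-- The `q`-th Frobenius power `I^{[q]}` of an ideal `I`: the ideal generated by the `q`-th powers
of the elements of `I`. In characteristic `p` and for `q = p ^ e` it is generated by the `q`-th
powers of any set of generators of `I`, see `frobeniusPower_span`. -/
def frobeniusPower {R : Type*} [CommRing R] (I : Ideal R) (q : ℕ) : Ideal R :=
  Ideal.span ((fun a : R => a ^ q) '' (I : Set R))

theorem frobeniusPower_span {R : Type*} [CommRing R] (p : ℕ) [ExpChar R p] (S : Set R) (e : ℕ) :
    frobeniusPower (Ideal.span S) (p ^ e) = Ideal.span ((fun a : R => a ^ (p ^ e)) '' S) :=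
  Ideal.map_span (iterateFrobenius R p e) S

/-- The Frobenius powers `I^{[p ^ e]}` of `I` have linear growth of primary decompositions:
there is a constant `c` such that every `I^{[q]}`, `q = p ^ e`, is the intersection of a finite set
of primary ideals `Q`, each of which contains `((√Q)^c)^{[q]}`. (The unit ideal is the empty
intersection.) -/
def HasLinearGrowthOfPrimaryDecompositions {R : Type*} [CommRing R] (p : ℕ) (I : Ideal R) : Prop :=
  ∃ c : ℕ, ∀ e : ℕ, ∃ s : Finset (Ideal R),
    s.inf id = frobeniusPower I (p ^ e) ∧
      ∀ Q ∈ s, Q.IsPrimary ∧ frobeniusPower (Q.radical ^ c) (p ^ e) ≤ Q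

/-! Put `A = k[t]` and `J = I^{[q]}`. In each degree `d`, `R / J` is the cokernel over `A` of a
matrix with at most `q` rows, indexed by the monomials of degree `d` outside `(x^q, y^q)`. Its
columns come from monomial multiples of the `f_i`, so its entries have `t`-degree at most some `D`
independent of `q`. A maximal nonzero minor `δ_d` kills the torsion of this cokernel and has degree
at most `q * D`; only degrees `d < 2 * q` matter.

If `z` is torsion modulo `J` and `z = j + δ_d w` with `j ∈ J`, then `w` is torsion too, so `δ_d`
kills its degree-`d` part and `z_d ∈ J`. Hence `J` is the intersection of its torsion closure with
the ideals `J + (δ_d)`, and these split into ideals `J + (g^n)` with `g` prime and `n ≤ q * D`.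
Since `R = A + I`, every proper ideal among these is primary, with radical inside `I` or `I + (g)`.
Thus `(√Q)^{c[q]} ⊆ J + (g^{qc}) ⊆ Q` for `c = D + 1`, without the `g` term for the torsion closure.
-/

/-! ### Torsion of cokernels of polynomial matrices -/

open Polynomial in
theorem natDegree_det_le_of_forall_le {k ι : Type*} [Field k] [Fintype ι] [DecidableEq ι]
    (M : Matrix ι ι k[X]) (D : ℕ) (hM : ∀ i j, (M i j).natDegree ≤ D) :
    M.det.natDegree ≤ Fintype.card ι * D := by
  rw [Matrix.det_apply]
  refine natDegree_sum_le_of_forall_le _ _ fun σ _ => ?_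
  rw [Units.smul_def, zsmul_eq_mul, ← C_eq_intCast]
  refine (natDegree_C_mul_le _ _).trans ((natDegree_prod_le _ _).trans ?_)
  exact (Finset.sum_le_card_nsmul _ _ D fun i _ => hM _ _).trans (by simp)

open Polynomial in
/-- A submodule of `k[X] ^ ι` spanned by vectors with entries of degree at most `D` has a cokernel
whose torsion is annihilated by a single nonzero polynomial of degree at most `card ι * D`. -/
theorem exists_natDegree_le_smul_mem_span {k ι : Type*} [Field k] [Fintype ι] [DecidableEq ι]
    (G : Set (ι → k[X])) (D : ℕ) (hG : ∀ v ∈ G, ∀ i, (v i).natDegree ≤ D) :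
    ∃ δ : k[X], δ ≠ 0 ∧ δ.natDegree ≤ Fintype.card ι * D ∧
      ∀ (v : ι → k[X]) (h : k[X]), h ≠ 0 → h • v ∈ Submodule.span k[X] G →
        δ • v ∈ Submodule.span k[X] G := by
  let K := FractionRing k[X]
  let φ : (ι → k[X]) →ₗ[k[X]] (ι → K) := (Algebra.linearMap k[X] K).compLeft ι
  have hφ (v : ι → k[X]) (i : ι) : φ v i = algebraMap k[X] K (v i) := rfl
  -- A maximal independent subset `b` of `G` is completed to a basis by standard vectors, whose
  -- entries have degree 0. The determinant of this basis is the required `δ`.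
  obtain ⟨b, hbG, hbspan, hb⟩ := exists_linearIndependent K (φ '' G)
  let t : Set (ι → K) := φ '' G ∪ Set.range fun i => φ (Pi.single i 1)
  obtain ⟨B, hBt, hbB, htB, hB⟩ :=
    exists_linearIndepOn_id_extension (K := K) hb (hbG.trans Set.subset_union_left : b ⊆ t)
  have htop : Submodule.span K B = ⊤ := by
    refine top_le_iff.mp ?_
    rw [← (Pi.basisFun K ι).span_eq]
    refine Submodule.span_le.mpr ?_
    rintro _ ⟨i, rfl⟩
    refine htB (Or.inr ⟨i, ?_⟩)
    ext j
    simp only [hφ, Pi.basisFun_apply, Pi.single_apply]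
    split_ifs <;> simp
  let 𝓑 : Module.Basis B K (ι → K) := Module.Basis.mk hB (by simp [htop])
  let e : B ≃ ι := 𝓑.indexEquiv (Pi.basisFun K ι)
  let β : Module.Basis ι K (ι → K) := 𝓑.reindex e
  have hβ (i : ι) : β i = (e.symm i : ι → K) := by simp [β, 𝓑]
  have hlift (i : ι) : ∃ c : ι → k[X], φ c = β i ∧ (∀ j, (c j).natDegree ≤ D) ∧
      (β i ∈ b → c ∈ G) := by
    by_cases hi : β i ∈ b
    · obtain ⟨c, hc, hci⟩ := hbG hi
      exact ⟨c, hci, hG c hc, fun _ => hc⟩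
    · have : β i ∈ t := by rw [hβ]; exact hBt (e.symm i).2
      rcases this with ⟨c, hc, hci⟩ | ⟨l, hl⟩
      · exact ⟨c, hci, hG c hc, fun _ => hc⟩
      · refine ⟨_, hl, fun j => ?_, fun h => absurd h hi⟩
        rw [Pi.single_apply]
        split_ifs <;> simp
  choose c hcβ hcD hcG using hlift
  let M : Matrix ι ι k[X] := Matrix.of c
  have hinj : Function.Injective (algebraMap k[X] K) := IsFractionRing.injective _ _
  refine ⟨M.det, ?_, natDegree_det_le_of_forall_le M D hcD, ?_⟩
  · intro h0
    have h1 : LinearIndependent K (M.map (algebraMap k[X] K)).row := by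
      convert β.linearIndependent using 1
      ext i j
      rw [← hcβ]
      rfl
    rw [Matrix.linearIndependent_rows_iff_isUnit, Matrix.isUnit_iff_isUnit_det,
      ← RingHom.mapMatrix_apply, ← RingHom.map_det, h0] at h1
    simp at h1
  · intro v h hh hv
    -- Cramer's rule: the coordinates of `det M • v` in the basis are polynomials.
    let w : ι → k[X] := Matrix.vecMul v M.adjugate
    have hw : M.det • v = ∑ j, w j • c j := by
      have : Matrix.vecMul w M = M.det • v := by
        rw [Matrix.vecMul_vecMul, Matrix.adjugate_mul, Matrix.vecMul_smul, Matrix.vecMul_one]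
      rw [← this, Matrix.vecMul_eq_sum]
      rfl
    have hrepr : β.repr (φ (M.det • v)) = Finsupp.equivFunOnFinite.symm
        fun j => algebraMap k[X] K (w j) := by
      have h1 : φ (M.det • v) = ∑ j, algebraMap k[X] K (w j) • β j := by
        simp [hw, map_sum, hcβ, algebraMap_smul]
      ext j
      rw [h1, β.repr_sum_self]
      rfl
    -- Over `K` the factor `h` is invertible, so `v` lies in the span of `b` and the coordinates
    -- outside `b` vanish.
    have hmem : φ (M.det • v) ∈ Submodule.span K (β '' {j | β j ∈ b}) := by
      have himg : β '' {j | β j ∈ b} = b := by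
        refine Set.Subset.antisymm (by rintro _ ⟨j, hj, rfl⟩; exact hj) fun z hz => ?_
        have : β (e ⟨z, hbB hz⟩) = z := by rw [hβ]; simp
        exact ⟨e ⟨z, hbB hz⟩, by simpa [this] using hz, this⟩
      rw [himg, hbspan]
      have h1 : φ (h • v) ∈ Submodule.span K (φ '' G) := by
        have h2 : φ (h • v) ∈ (Submodule.span k[X] G).map φ := ⟨_, hv, rfl⟩
        rw [Submodule.map_span] at h2
        exact Submodule.span_le_restrictScalars k[X] K _ h2
      have hne : algebraMap k[X] K h ≠ 0 := by simpa using hh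
      rw [map_smul, algebra_compatible_smul K, Submodule.smul_mem_iff _ hne] at h1
      rw [map_smul, algebra_compatible_smul K]
      exact Submodule.smul_mem _ _ h1
    rw [Module.Basis.mem_span_image, hrepr] at hmem
    rw [hw]
    refine Submodule.sum_mem _ fun j _ => ?_
    by_cases hj : β j ∈ b
    · exact Submodule.smul_mem _ _ (Submodule.subset_span (hcG j hj))
    · have : w j = 0 := by
        by_contra hne
        exact hj (hmem (by simpa using hne))
      simp [this]

/-! ### Primary components and their radicals -/

section PrimaryDecomposition

variable {A R : Type*} [CommRing A] [CommRing R] [Algebra A R]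

/-- Modulo `Q`, every `v` is some `a` from `A` plus a nilpotent. If `a ∈ P`, then `v` is nilpotent;
otherwise `a`, and hence `v`, is a nonzerodivisor. -/
theorem le_sup_radical_and_isPrimary {I Q : Ideal R} {P : Ideal A} [P.IsPrime]
    (hI : ∀ v : R, ∃ a : A, v - algebraMap A R a ∈ I) (hIQ : I ≤ Q.radical) (hQ : Q ≠ ⊤)
    (hP : ∀ a ∈ P, algebraMap A R a ∈ Q.radical)
    (hreg : ∀ a ∉ P, ∀ u : R, algebraMap A R a * u ∈ Q → u ∈ Q) :
    Q.IsPrimary ∧ Q.radical ≤ I ⊔ P.map (algebraMap A R) := by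
  constructor
  · rw [Ideal.isPrimary_iff]
    refine ⟨hQ, fun {u v} huv => ?_⟩
    obtain ⟨a, ha⟩ := hI v
    by_cases haP : a ∈ P
    · right
      simpa using add_mem (hIQ ha) (hP a haP)
    · left
      obtain ⟨n, hn⟩ := hIQ ha
      refine hreg (a ^ n) (fun h => haP (Ideal.IsPrime.mem_of_pow_mem ‹_› n h)) u ?_
      -- Modulo `v`, the element `(v - a)^n ∈ Q` is `± a^n`, so `u * v ∈ Q` gives `a^n * u ∈ Q`.
      have h1 : v ∣ (v - algebraMap A R a) ^ n - (-algebraMap A R a) ^ n := by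
        simpa using sub_dvd_pow_sub_pow (v - algebraMap A R a) (-algebraMap A R a) n
      obtain ⟨w, hw⟩ := h1
      have h2 : algebraMap A R (a ^ n) * u =
          (-1) ^ n * ((v - algebraMap A R a) ^ n * u - w * (u * v)) := by
        have h3 : (-1 : R) ^ n * (-1) ^ n = 1 := by rw [← mul_pow]; simp
        rw [neg_pow] at hw
        rw [map_pow]
        linear_combination -(-1) ^ n * u * hw - (algebraMap A R a) ^ n * u * h3
      rw [h2]
      exact Q.mul_mem_left _ (sub_mem (Q.mul_mem_right _ hn) (Q.mul_mem_left _ huv))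
  · intro v hv
    obtain ⟨a, ha⟩ := hI v
    have haP : a ∈ P := by
      by_contra haP
      have h1 : algebraMap A R a ∈ Q.radical := by
        simpa using sub_mem hv (hIQ ha)
      obtain ⟨n, hn⟩ := h1
      rw [← map_pow] at hn
      refine hQ ((Ideal.eq_top_iff_one _).mpr (hreg (a ^ n) (fun h => haP
        (Ideal.IsPrime.mem_of_pow_mem ‹_› n h)) 1 (by simpa using hn)))
    simpa using add_mem (Ideal.mem_sup_left ha : _ ∈ I ⊔ P.map (algebraMap A R))
      (Ideal.mem_sup_right (Ideal.mem_map_of_mem _ haP))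

theorem sup_pow_le_sup_pow (I J : Ideal R) (n : ℕ) : (I ⊔ J) ^ n ≤ I ⊔ J ^ n := by
  induction n with
  | zero => simp
  | succ n ih =>
    rw [pow_succ]
    refine (Ideal.mul_mono_left ih).trans ?_
    rw [Ideal.sup_mul, Ideal.mul_sup (J ^ n), ← pow_succ]
    have h1 : I * (I ⊔ J) ≤ I := Ideal.mul_le_left
    have h2 : J ^ n * I ≤ I := Ideal.mul_le_right
    exact sup_le (le_sup_of_le_left h1) (sup_le (le_sup_of_le_left h2) le_sup_right)

theorem frobeniusPower_eq_map (p : ℕ) [ExpChar R p] (I : Ideal R) (e : ℕ) :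
    frobeniusPower I (p ^ e) = I.map (iterateFrobenius R p e) := rfl

/-- Extension along Frobenius respects sums and products. The `I` part is absorbed by `I^{[q]}`, so
only `K` has to supply the exponent `c`. -/
theorem frobeniusPower_pow_le_of_le (p : ℕ) [ExpChar R p] {I J K : Ideal R} (h : J ≤ I ⊔ K)
    (c e : ℕ) : frobeniusPower (J ^ c) (p ^ e) ≤
      frobeniusPower I (p ^ e) ⊔ frobeniusPower K (p ^ e) ^ c := by
  simp only [frobeniusPower_eq_map, Ideal.map_pow]
  refine (Ideal.pow_right_mono (Ideal.map_mono h) c).trans ?_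
  rw [Ideal.map_sup]
  exact sup_pow_le_sup_pow _ _ _

/-- Intersection of the ideals `J + (g ^ n)`, where `g ^ n` ranges over the prime powers exactly
dividing `δ`. -/
theorem exists_finset_prime_pow_inf_le [IsDomain A] [IsPrincipalIdealRing A] (J : Ideal R) (δ : A)
    (hδ : δ ≠ 0) :
    ∃ s : Finset (Ideal R), s.inf id ≤ J ⊔ Ideal.span {algebraMap A R δ} ∧
      J ≤ s.inf id ∧
      ∀ Q ∈ s, ∃ (g : A) (n : ℕ), Prime g ∧ n ≠ 0 ∧ g ^ n ∣ δ ∧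
        Q = J ⊔ Ideal.span {algebraMap A R (g ^ n)} := by
  classical
  revert hδ
  refine UniqueFactorizationMonoid.induction_on_coprime δ (by simp) ?_ ?_ ?_
  · intro u hu _
    refine ⟨∅, ?_, by simp, by simp⟩
    rw [Ideal.span_singleton_eq_top.mpr (hu.map _)]
    simp
  · intro g n hg _
    rcases eq_or_ne n 0 with rfl | hn
    · exact ⟨∅, by simp, by simp, by simp⟩
    · refine ⟨{J ⊔ Ideal.span {algebraMap A R (g ^ n)}}, by simp, by simp, fun Q hQ => ?_⟩
      exact ⟨g, n, hg, hn, dvd_rfl, by simpa using hQ⟩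
  · intro a b hab iha ihb h0
    obtain ⟨s, hs, hs', hsQ⟩ := iha (left_ne_zero_of_mul h0)
    obtain ⟨t, ht, ht', htQ⟩ := ihb (right_ne_zero_of_mul h0)
    refine ⟨s ∪ t, ?_, ?_, fun Q hQ => ?_⟩
    · intro z hz
      rw [Finset.inf_union] at hz
      obtain ⟨j₁, hj₁, w₁, hw₁, h₁⟩ := Submodule.mem_sup.mp (hs hz.1)
      obtain ⟨j₂, hj₂, w₂, hw₂, h₂⟩ := Submodule.mem_sup.mp (ht hz.2)
      obtain ⟨c₁, rfl⟩ := Ideal.mem_span_singleton'.mp hw₁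
      obtain ⟨c₂, rfl⟩ := Ideal.mem_span_singleton'.mp hw₂
      -- With `α a + β b = 1`, write `z = α a z + β b z`, using `z ∈ J + (b)` in the first term and
      -- `z ∈ J + (a)` in the second.
      obtain ⟨α, β, hαβ⟩ := hab.isCoprime
      have h3 := congrArg (algebraMap A R) hαβ
      simp only [map_add, map_mul, map_one] at h3
      refine Submodule.mem_sup.mpr ⟨algebraMap A R α * algebraMap A R a * j₂ +
        algebraMap A R β * algebraMap A R b * j₁,
        add_mem (J.mul_mem_left _ hj₂) (J.mul_mem_left _ hj₁),
        (algebraMap A R α * c₂ + algebraMap A R β * c₁) * algebraMap A R (a * b),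
        Ideal.mem_span_singleton'.mpr ⟨_, rfl⟩, ?_⟩
      rw [map_mul]
      linear_combination (algebraMap A R α * algebraMap A R a) * h₂ +
        (algebraMap A R β * algebraMap A R b) * h₁ + z * h3
    · rw [Finset.inf_union]
      exact le_inf hs' ht'
    · rcases Finset.mem_union.mp hQ with h | h
      · obtain ⟨g, n, h1, h2, h3, h4⟩ := hsQ Q h
        exact ⟨g, n, h1, h2, h3.mul_right _, h4⟩
      · obtain ⟨g, n, h1, h2, h3, h4⟩ := htQ Q h
        exact ⟨g, n, h1, h2, h3.mul_left _, h4⟩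

/-- The elements of `R` that are `A`-torsion modulo `J`. -/
def torsionClosure [IsDomain A] (J : Ideal R) : Ideal R where
  carrier := {z | ∃ h : A, h ≠ 0 ∧ algebraMap A R h * z ∈ J}
  zero_mem' := ⟨1, one_ne_zero, by simp⟩
  add_mem' := by
    rintro z w ⟨h, hh, hz⟩ ⟨l, hl, hw⟩
    refine ⟨h * l, mul_ne_zero hh hl, ?_⟩
    have : algebraMap A R (h * l) * (z + w) = algebraMap A R l * (algebraMap A R h * z) +
        algebraMap A R h * (algebraMap A R l * w) := by rw [map_mul]; ring
    rw [this]
    exact add_mem (J.mul_mem_left _ hz) (J.mul_mem_left _ hw)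
  smul_mem' := by
    rintro c z ⟨h, hh, hz⟩
    refine ⟨h, hh, ?_⟩
    rw [smul_eq_mul, mul_left_comm]
    exact J.mul_mem_left _ hz

theorem le_torsionClosure [IsDomain A] (J : Ideal R) : J ≤ torsionClosure (A := A) J :=
  fun z hz => ⟨1, one_ne_zero, by simpa using hz⟩

theorem mem_torsionClosure_of_mul_mem [IsDomain A] {J : Ideal R} {a : A} (ha : a ≠ 0) {u : R}
    (h : algebraMap A R a * u ∈ torsionClosure (A := A) J) : u ∈ torsionClosure (A := A) J := by
  obtain ⟨l, hl, h⟩ := h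
  exact ⟨l * a, mul_ne_zero hl ha, by rwa [map_mul, mul_assoc]⟩

open Polynomial in
/-- Let `I` be an ideal of a `k[X]`-algebra `R` with `R = k[X] + I`. If the torsion of each
`R / I^{[q]}` is detected modulo finitely many polynomials of degree at most `D * q`, then the
Frobenius powers of `I` have linear growth of primary decompositions. -/
theorem hasLinearGrowthOfPrimaryDecompositions_of_torsion {k R : Type*} [Field k] [CommRing R]
    [Algebra k[X] R] (p : ℕ) [ExpChar R p] (I : Ideal R)
    (hI : ∀ v : R, ∃ a : k[X], v - algebraMap k[X] R a ∈ I)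
    (hrad : ∀ e, I ≤ (frobeniusPower I (p ^ e)).radical) (D : ℕ)
    (hT : ∀ e : ℕ, ∃ (m : ℕ) (δ : Fin m → k[X]),
      (∀ i, δ i ≠ 0 ∧ (δ i).natDegree ≤ p ^ e * D) ∧
      ∀ z ∈ torsionClosure (A := k[X]) (frobeniusPower I (p ^ e)),
        (∀ i, z ∈ frobeniusPower I (p ^ e) ⊔ Ideal.span {algebraMap k[X] R (δ i)}) →
        z ∈ frobeniusPower I (p ^ e)) :
    HasLinearGrowthOfPrimaryDecompositions p I := by
  classical
  -- `D` suffices for the components `J + (g^n)`; the extra 1 makes the exponent nonzero, so that `⊥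
  -- ^ c = ⊥` for the torsion closure.
  refine ⟨D + 1, fun e => ?_⟩
  obtain ⟨m, δ, hδ, hz⟩ := hT e
  set J := frobeniusPower I (p ^ e) with hJ
  choose s hs hs' hsQ using fun i => exists_finset_prime_pow_inf_le J (δ i) (hδ i).1
  let S : Finset (Ideal R) := insert (torsionClosure (A := k[X]) J) (Finset.univ.biUnion s)
  -- Primary ideals are proper; dropping `⊤` does not change the intersection.
  refine ⟨S.filter (· ≠ ⊤), ?_, fun Q hQ => ?_⟩
  · have h1 : (S.filter (· ≠ ⊤)).inf id = S.inf id := by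
      refine le_antisymm (Finset.le_inf fun Q hQ => ?_) (Finset.inf_mono (Finset.filter_subset _ _))
      by_cases h : Q = ⊤
      · simp [h]
      · exact Finset.inf_le (f := id) (Finset.mem_filter.mpr ⟨hQ, h⟩)
    rw [h1, Finset.inf_insert, Finset.inf_biUnion]
    refine le_antisymm (fun z hzz => ?_) (le_inf (le_torsionClosure J) (Finset.le_inf fun i _ => hs' i))
    exact hz z hzz.1 fun i => hs i ((Finset.inf_le (Finset.mem_univ i) :
      (Finset.univ.inf fun i => (s i).inf id) ≤ _) hzz.2)
  · obtain ⟨hQS, hQtop⟩ := Finset.mem_filter.mp hQ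
    rcases Finset.mem_insert.mp hQS with rfl | hQs
    · obtain ⟨h1, h2⟩ := le_sup_radical_and_isPrimary (A := k[X]) (P := ⊥) hI
        ((hrad e).trans (Ideal.radical_mono (le_torsionClosure J))) hQtop
        (fun a ha => by rw [Ideal.mem_bot.mp ha, map_zero]; exact zero_mem _)
        (fun a ha u hu => mem_torsionClosure_of_mul_mem ha hu)
      refine ⟨h1, (frobeniusPower_pow_le_of_le p h2 _ e).trans ?_⟩
      rw [Ideal.map_bot, frobeniusPower_eq_map p ⊥, Ideal.map_bot, Ideal.bot_pow (by simp),
        sup_bot_eq]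
      exact le_torsionClosure J
    · obtain ⟨i, -, hQi⟩ := Finset.mem_biUnion.mp hQs
      obtain ⟨g, n, hg, hn, hgn, rfl⟩ := hsQ i Q hQi
      have hgm : (Ideal.span {g}).IsPrime := (Ideal.span_singleton_prime hg.ne_zero).mpr hg
      obtain ⟨h1, h2⟩ := le_sup_radical_and_isPrimary (A := k[X]) (P := Ideal.span {g}) hI
        ((hrad e).trans (Ideal.radical_mono le_sup_left)) hQtop
        (fun a ha => by
          obtain ⟨c, rfl⟩ := Ideal.mem_span_singleton'.mp ha
          refine ⟨n, Ideal.mem_sup_right (Ideal.mem_span_singleton'.mpr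
            ⟨algebraMap k[X] R (c ^ n), ?_⟩)⟩
          rw [← map_mul, ← map_pow, mul_pow])
        (fun a ha u hu => by
          have hcop : IsCoprime (g ^ n) a := IsCoprime.pow_left
            ((hg.irreducible.coprime_iff_not_dvd).mpr fun h => ha (Ideal.mem_span_singleton.mpr h))
          obtain ⟨α, β, hαβ⟩ := hcop
          have h3 := congrArg (algebraMap k[X] R) hαβ
          simp only [map_add, map_mul, map_one] at h3
          have h4 : u = algebraMap k[X] R α * u * algebraMap k[X] R (g ^ n) +
            algebraMap k[X] R β * (algebraMap k[X] R a * u) := by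
            linear_combination -u * h3
          rw [h4]
          exact add_mem (Ideal.mem_sup_right (Ideal.mem_span_singleton'.mpr ⟨_, rfl⟩))
            (Ideal.mul_mem_left _ _ hu))
      refine ⟨h1, (frobeniusPower_pow_le_of_le p h2 _ e).trans (sup_le_sup_left ?_ _)⟩
      -- A prime `g` of `k[t]` has positive degree, so `n ≤ deg (g^n) ≤ deg δ ≤ q * D`.
      have hnle : n ≤ p ^ e * (D + 1) := by
        have h3 : n ≤ (g ^ n).natDegree := by
          rw [natDegree_pow]
          exact Nat.le_mul_of_pos_right _ (hg.irreducible.natDegree_pos)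
        have h4 := natDegree_le_of_dvd hgn (hδ i).1
        have h5 := (hδ i).2
        rw [Nat.mul_succ]
        exact h3.trans (h4.trans (h5.trans (Nat.le_add_right _ _)))
      rw [Ideal.map_span, Set.image_singleton, frobeniusPower_span, Set.image_singleton,
        Ideal.span_singleton_pow, ← pow_mul, Ideal.span_singleton_le_span_singleton, map_pow]
      exact pow_dvd_pow _ hnle

end PrimaryDecomposition

/-! ### Graded pieces modulo `x^q` and `y^q` -/

section Truncation

open MvPolynomial

variable {A : Type*} [CommRing A]

/-- The exponent vector of `x ^ a * y ^ b`. -/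
noncomputable def bidegree (a b : ℕ) : Fin 2 →₀ ℕ := Finsupp.single 0 a + Finsupp.single 1 b

theorem bidegree_zero (a b : ℕ) : bidegree a b 0 = a := by simp [bidegree]

theorem bidegree_one (a b : ℕ) : bidegree a b 1 = b := by simp [bidegree]

theorem eq_bidegree (m : Fin 2 →₀ ℕ) : m = bidegree (m 0) (m 1) := by
  ext i
  fin_cases i
  · exact (bidegree_zero _ _).symm
  · exact (bidegree_one _ _).symm

theorem degree_eq_add (m : Fin 2 →₀ ℕ) : m.degree = m 0 + m 1 := by
  rw [Finsupp.degree_eq_sum, Fin.sum_univ_two]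

/-- The coefficients of the monomials `x ^ a * y ^ (d - a)` that are divisible neither by `x ^ q`
nor by `y ^ q`. -/
noncomputable def truncatedCoeff (A : Type*) [CommRing A] (q d : ℕ) :
    MvPolynomial (Fin 2) A →ₗ[A] (Fin q → A) where
  -- The exponents are `a < q` and `d - a < q`. Padding with zeros gives every degree the same
  -- target of rank `q`.
  toFun f a := if a ≤ d ∧ d < a + q then coeff (bidegree a (d - a)) f else 0
  map_add' f g := by
    ext a
    simp only [coeff_add, Pi.add_apply]
    split_ifs <;> simp
  map_smul' c f := by
    ext a
    simp only [coeff_smul, Pi.smul_apply, RingHom.id_apply]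
    split_ifs <;> simp

theorem truncatedCoeff_apply (q d : ℕ) (f : MvPolynomial (Fin 2) A) (a : Fin q) :
    truncatedCoeff A q d f a =
      if a ≤ d ∧ d < a + q then coeff (bidegree a (d - a)) f else 0 := rfl

theorem truncatedCoeff_eq_zero_of_le {q d : ℕ} (h : 2 * q ≤ d) (f : MvPolynomial (Fin 2) A) :
    truncatedCoeff A q d f = 0 := by
  ext a
  rw [truncatedCoeff_apply, if_neg (by omega)]
  rfl

theorem truncatedCoeff_homogeneousComponent (q d : ℕ) (f : MvPolynomial (Fin 2) A) :
    truncatedCoeff A q d (homogeneousComponent d f) = truncatedCoeff A q d f := by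
  ext a
  rw [truncatedCoeff_apply, truncatedCoeff_apply]
  split_ifs with h
  · rw [coeff_homogeneousComponent, degree_eq_add, bidegree_zero, bidegree_one, if_pos (by omega)]
  · rfl

theorem truncatedCoeff_mul_X_pow (q d : ℕ) (i : Fin 2) (f : MvPolynomial (Fin 2) A) :
    truncatedCoeff A q d (f * X i ^ q) = 0 := by
  ext a
  rw [truncatedCoeff_apply]
  split_ifs with h
  · rw [X_pow_eq_monomial, coeff_mul_monomial', if_neg]
    · rfl
    · intro hle
      have := hle i
      rw [Finsupp.single_eq_same] at this
      fin_cases i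
      · have h2 : q ≤ bidegree a (d - a) 0 := this
        rw [bidegree_zero] at h2
        omega
      · have h2 : q ≤ bidegree a (d - a) 1 := this
        rw [bidegree_one] at h2
        omega
  · rfl

/-- Each monomial that truncation forgets in degree `d` is divisible by `x^q` or `y^q`. -/
theorem mem_span_X_pow_of_truncatedCoeff_eq_zero {q d : ℕ} {f : MvPolynomial (Fin 2) A}
    (hf : f.IsHomogeneous d) (h : truncatedCoeff A q d f = 0) :
    f ∈ Ideal.span {(X 0 ^ q : MvPolynomial (Fin 2) A), X 1 ^ q} := by
  rw [f.as_sum]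
  refine sum_mem fun m hm => ?_
  have hdeg : m 0 + m 1 = d := by
    rw [← degree_eq_add]
    by_contra hne
    exact (mem_support_iff.mp hm) (hf.coeff_eq_zero hne)
  have key (i : Fin 2) (hi : q ≤ m i) : monomial m (coeff m f) =
      monomial (m - Finsupp.single i q) (coeff m f) * X i ^ q := by
    rw [X_pow_eq_monomial, monomial_mul, mul_one, tsub_add_cancel_of_le]
    exact Finsupp.single_le_iff.mpr hi
  by_cases h0 : q ≤ m 0
  · rw [key 0 h0]
    exact Ideal.mul_mem_left _ _ (Ideal.subset_span (by simp))
  by_cases h1 : q ≤ m 1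
  · rw [key 1 h1]
    exact Ideal.mul_mem_left _ _ (Ideal.subset_span (by simp))
  exfalso
  refine (mem_support_iff.mp hm) ?_
  have h2 := congrFun h ⟨m 0, by omega⟩
  rw [truncatedCoeff_apply, if_pos (by simp only; omega)] at h2
  simp only [show d - m 0 = m 1 by omega, ← eq_bidegree] at h2
  exact h2

attribute [local instance] MvPolynomial.gradedAlgebra in
/-- Membership in a homogeneous ideal containing `x ^ q` and `y ^ q` is detected by the truncated
coefficients in each degree. -/
theorem mem_of_forall_truncatedCoeff_mem {q : ℕ} {L : Ideal (MvPolynomial (Fin 2) A)}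
    (hL : L.IsHomogeneous (homogeneousSubmodule (Fin 2) A))
    (hX : Ideal.span {(X 0 ^ q : MvPolynomial (Fin 2) A), X 1 ^ q} ≤ L)
    {f : MvPolynomial (Fin 2) A}
    (hf : ∀ d, truncatedCoeff A q d f ∈ (L.restrictScalars A).map (truncatedCoeff A q d)) :
    f ∈ L := by
  rw [mem_iff_homogeneousComponent_mem hL]
  intro d
  obtain ⟨l, hl, hlf⟩ := hf d
  have h1 : homogeneousComponent d f - homogeneousComponent d l ∈ L := by
    refine hX (mem_span_X_pow_of_truncatedCoeff_eq_zero (d := d) ?_ ?_)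
    · exact (homogeneousComponent_isHomogeneous d f).sub (homogeneousComponent_isHomogeneous d l)
    · rw [map_sub, truncatedCoeff_homogeneousComponent, truncatedCoeff_homogeneousComponent, hlf,
        sub_self]
  simpa using add_mem h1 (homogeneousComponent_mem_of_mem hL hl d)

/-- Multipliers of `F i` expand `A`-linearly into monomials with coefficient 1, so the generators on
the right have coefficients no worse than those of `F`, whatever `q` is. -/
theorem map_truncatedCoeff_span {ι : Type*} [Fintype ι] (F : ι → MvPolynomial (Fin 2) A) (q d : ℕ) :
    ((Ideal.span (Set.range F) ⊔
      Ideal.span {(X 0 ^ q : MvPolynomial (Fin 2) A), X 1 ^ q}).restrictScalars A).map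
        (truncatedCoeff A q d) =
      Submodule.span A (Set.range fun im : ι × (Fin 2 →₀ ℕ) =>
        truncatedCoeff A q d (F im.1 * monomial im.2 1)) := by
  refine le_antisymm ?_ (Submodule.span_le.mpr ?_)
  · rintro _ ⟨l, hl, rfl⟩
    obtain ⟨l₁, h₁, l₂, h₂, rfl⟩ := Submodule.mem_sup.mp hl
    rw [map_add]
    refine add_mem ?_ ?_
    · obtain ⟨c, rfl⟩ := Ideal.mem_span_range_iff_exists_fun.mp h₁
      rw [map_sum]
      refine sum_mem fun i _ => ?_
      rw [(c i).as_sum, Finset.sum_mul, map_sum]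
      refine sum_mem fun m _ => ?_
      have h3 : monomial m (coeff m (c i)) * F i = coeff m (c i) • (F i * monomial m 1) := by
        rw [mul_comm, ← mul_smul_comm, smul_monomial, smul_eq_mul, mul_one]
      rw [h3, map_smul]
      exact Submodule.smul_mem _ _ (Submodule.subset_span ⟨(i, m), rfl⟩)
    · obtain ⟨a, b, rfl⟩ := Ideal.mem_span_pair.mp h₂
      rw [map_add, truncatedCoeff_mul_X_pow, truncatedCoeff_mul_X_pow, add_zero]
      exact zero_mem _
  · rintro _ ⟨⟨i, m⟩, rfl⟩
    exact ⟨_, Ideal.mem_sup_left (Ideal.mul_mem_right _ _ (Ideal.subset_span ⟨i, rfl⟩)), rfl⟩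

end Truncation

/-! ### Uniform degree bounds and passage to the quotient ring -/

section LinearGrowth

open MvPolynomial

theorem exists_natDegree_coeff_le {k σ ι : Type*} [Field k] [Fintype ι]
    (F : ι → MvPolynomial σ (Polynomial k)) :
    ∃ D : ℕ, ∀ i m, (coeff m (F i)).natDegree ≤ D := by
  refine ⟨Finset.univ.sup fun i => (F i).support.sup fun m => (coeff m (F i)).natDegree,
    fun i m => ?_⟩
  by_cases hm : m ∈ (F i).support
  · exact (Finset.le_sup (f := fun m => (coeff m (F i)).natDegree) hm).trans
      (Finset.le_sup (f := fun i => (F i).support.sup fun m => (coeff m (F i)).natDegree)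
        (Finset.mem_univ i))
  · simp [notMem_support_iff.mp hm]

theorem natDegree_truncatedCoeff_mul_monomial_le {k : Type*} [Field k]
    {f : MvPolynomial (Fin 2) (Polynomial k)} {D : ℕ} (hf : ∀ m, (coeff m f).natDegree ≤ D)
    (q d : ℕ) (m : Fin 2 →₀ ℕ) (a : Fin q) :
    (truncatedCoeff (Polynomial k) q d (f * monomial m 1) a).natDegree ≤ D := by
  rw [truncatedCoeff_apply, coeff_mul_monomial']
  split_ifs <;> simp [hf]

attribute [local instance] MvPolynomial.gradedAlgebra in
theorem isHomogeneous_span_sup_span_X_pow {A ι : Type*} [CommRing A]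
    {F : ι → MvPolynomial (Fin 2) A} (hF : ∀ i, ∃ d, (F i).IsHomogeneous d) (q : ℕ) :
    (Ideal.span (Set.range F) ⊔ Ideal.span {X 0 ^ q, X 1 ^ q}).IsHomogeneous
      (homogeneousSubmodule (Fin 2) A) := by
  rw [← Ideal.span_union]
  refine Ideal.homogeneous_span _ _ ?_
  rintro _ (⟨i, rfl⟩ | rfl | rfl)
  · exact hF i
  · exact ⟨q, by simpa using (isHomogeneous_X A (0 : Fin 2)).pow q⟩
  · exact ⟨q, by simpa using (isHomogeneous_X A (1 : Fin 2)).pow q⟩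

/-- The torsion over `k[t]` of `k[t][x, y] / (F, x ^ q, y ^ q)` is detected modulo `2 * q`
polynomials in `t` of degree at most `q * D`. -/
theorem exists_detecting_torsion {k ι : Type*} [Field k] [Fintype ι]
    {F : ι → MvPolynomial (Fin 2) (Polynomial k)} (hF : ∀ i, ∃ d, (F i).IsHomogeneous d)
    {D : ℕ} (hD : ∀ i m, (coeff m (F i)).natDegree ≤ D) (q : ℕ)
    {L : Ideal (MvPolynomial (Fin 2) (Polynomial k))}
    (hL : L = Ideal.span (Set.range F) ⊔ Ideal.span {X 0 ^ q, X 1 ^ q}) :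
    ∃ δ : Fin (2 * q) → Polynomial k, (∀ i, δ i ≠ 0 ∧ (δ i).natDegree ≤ q * D) ∧
      ∀ (f : MvPolynomial (Fin 2) (Polynomial k)) (h : Polynomial k), h ≠ 0 → C h * f ∈ L →
        (∀ i, ∃ w, f - C (δ i) * w ∈ L) → f ∈ L := by
  have hG (d : ℕ) := exists_natDegree_le_smul_mem_span
    (Set.range fun im : ι × (Fin 2 →₀ ℕ) =>
        truncatedCoeff (Polynomial k) q d (F im.1 * monomial im.2 1)) D
    (by rintro _ ⟨⟨i, m⟩, rfl⟩ a
        exact natDegree_truncatedCoeff_mul_monomial_le (hD i) q d m a)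
  choose δ hδ0 hδD hδ using hG
  refine ⟨fun d => δ d, fun d => ⟨hδ0 d, by simpa using hδD d⟩, fun f h hh hf hw => ?_⟩
  subst hL
  refine mem_of_forall_truncatedCoeff_mem (isHomogeneous_span_sup_span_X_pow hF q) le_sup_right
    fun d => ?_
  rw [map_truncatedCoeff_span]
  have hT : ∀ g ∈ Ideal.span (Set.range F) ⊔ Ideal.span {X 0 ^ q, X 1 ^ q},
      truncatedCoeff (Polynomial k) q d g ∈ Submodule.span (Polynomial k)
        (Set.range fun im : ι × (Fin 2 →₀ ℕ) =>
          truncatedCoeff (Polynomial k) q d (F im.1 * monomial im.2 1)) := fun g hg => by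
    rw [← map_truncatedCoeff_span]
    exact ⟨g, hg, rfl⟩
  by_cases hd : d < 2 * q
  · obtain ⟨w, hw⟩ := hw ⟨d, hd⟩
    simp only at hw
    -- Since `f ≡ δ_d w` modulo `L` and `f` is torsion, `w` is torsion as well; hence `δ_d` kills
    -- its degree-`d` truncation.
    have h1 : C (h * δ d) * w ∈ Ideal.span (Set.range F) ⊔ Ideal.span {X 0 ^ q, X 1 ^ q} := by
      have : C (h * δ d) * w = C h * f - C h * (f - C (δ d) * w) := by rw [C_mul]; ring
      rw [this]
      exact sub_mem hf (Ideal.mul_mem_left _ _ hw)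
    have h2 := hT _ h1
    rw [C_mul', map_smul] at h2
    have h3 := add_mem (hT _ hw) (hδ d _ _ (mul_ne_zero hh (hδ0 d)) h2)
    rwa [map_sub, C_mul', map_smul, sub_add_cancel] at h3
  · rw [truncatedCoeff_eq_zero_of_le (by omega)]
    exact zero_mem _

open Polynomial in
theorem hasLinearGrowthOfPrimaryDecompositions_of_surjective {k R ι : Type*} [Field k] (p : ℕ)
    [Fact p.Prime] [CharP k p] [CommRing R] [Fintype ι]
    {F : ι → MvPolynomial (Fin 2) k[X]} (hF : ∀ i, ∃ d, (F i).IsHomogeneous d)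
    (π : MvPolynomial (Fin 2) k[X] →+* R) (hπ : Function.Surjective π)
    (hker : RingHom.ker π = Ideal.span (Set.range F)) :
    HasLinearGrowthOfPrimaryDecompositions p
      (Ideal.span {π (MvPolynomial.X 0), π (MvPolynomial.X 1)}) := by
  -- The zero ring does not have characteristic `p`; there the empty intersection serves.
  rcases subsingleton_or_nontrivial R with hR | hR
  · exact ⟨0, fun e => ⟨∅, Subsingleton.elim _ _, by simp⟩⟩
  have : CharP R p := charP_of_injective_ringHom
    ((π.comp MvPolynomial.C).comp Polynomial.C).injective p
  have : ExpChar R p := ExpChar.prime Fact.out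
  let _ : Algebra k[X] R := (π.comp MvPolynomial.C).toAlgebra
  have halg (a : k[X]) : algebraMap k[X] R a = π (MvPolynomial.C a) := rfl
  obtain ⟨D, hD⟩ := exists_natDegree_coeff_le F
  refine hasLinearGrowthOfPrimaryDecompositions_of_torsion (k := k) p _ (fun v => ?_) (fun e => ?_) D
    fun e => ?_
  · obtain ⟨f, rfl⟩ := hπ v
    induction f using MvPolynomial.induction_on with
    | C a => exact ⟨a, by simp [halg]⟩
    | add f g hf hg =>
      obtain ⟨a, ha⟩ := hf
      obtain ⟨b, hb⟩ := hg
      refine ⟨a + b, ?_⟩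
      rw [map_add, map_add, add_sub_add_comm]
      exact add_mem ha hb
    | mul_X f i _ =>
      refine ⟨0, ?_⟩
      rw [map_zero, sub_zero, map_mul]
      refine Ideal.mul_mem_left _ _ (Ideal.subset_span ?_)
      fin_cases i <;> simp
  · intro z hz
    exact ⟨p ^ e, Ideal.subset_span ⟨z, hz, rfl⟩⟩
  · set L := Ideal.span (Set.range F) ⊔
      Ideal.span {MvPolynomial.X 0 ^ p ^ e, MvPolynomial.X 1 ^ p ^ e} with hL
    obtain ⟨δ, hδ, hδT⟩ := exists_detecting_torsion hF hD (p ^ e) hL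
    have hJ (f : MvPolynomial (Fin 2) k[X]) : π f ∈ frobeniusPower
        (Ideal.span {π (MvPolynomial.X 0), π (MvPolynomial.X 1)}) (p ^ e) ↔ f ∈ L := by
      have h1 : frobeniusPower (Ideal.span {π (MvPolynomial.X 0), π (MvPolynomial.X 1)}) (p ^ e) =
          (Ideal.span {MvPolynomial.X 0 ^ p ^ e, MvPolynomial.X 1 ^ p ^ e}).map π := by
        rw [frobeniusPower_span, Ideal.map_span]
        simp [Set.image_pair]
      rw [h1, ← Ideal.mem_comap, Ideal.comap_map_of_surjective' π hπ, hker, sup_comm]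
    refine ⟨_, δ, hδ, fun z hz hzδ => ?_⟩
    obtain ⟨f, rfl⟩ := hπ z
    obtain ⟨h, hh, hz⟩ := hz
    rw [hJ]
    rw [halg, ← map_mul, hJ] at hz
    refine hδT f h hh hz fun i => ?_
    obtain ⟨j, hj, w, hw, hjw⟩ := Submodule.mem_sup.mp (hzδ i)
    obtain ⟨c, rfl⟩ := Ideal.mem_span_singleton'.mp hw
    obtain ⟨w, rfl⟩ := hπ c
    refine ⟨w, ?_⟩
    rw [← hJ, map_sub, ← hjw, map_mul, mul_comm, halg, add_sub_cancel_right]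
    exact hj

/-- The isomorphism `k[t, x, y] ≃ k[t][x, y]`. -/
noncomputable def polynomialEquiv (k : Type*) [Field k] :
    MvPolynomial (Fin 3) k ≃ₐ[k] MvPolynomial (Fin 2) (Polynomial k) :=
  (renameEquiv k (_root_.finSuccEquiv 2)).trans (optionEquivRight k (Fin 2))

theorem polynomialEquiv_X_zero (k : Type*) [Field k] :
    polynomialEquiv k (X 0) = C Polynomial.X := by
  simp [polynomialEquiv]

theorem polynomialEquiv_X_succ (k : Type*) [Field k] (i : Fin 2) :
    polynomialEquiv k (X i.succ) = X i := by
  simp [polynomialEquiv]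

/-- As `t` has weight 0, moving it into the coefficients turns weighted degree into total degree in
`x, y`. -/
theorem IsWeightedHomogeneous.isHomogeneous_polynomialEquiv {k : Type*} [Field k]
    {f : MvPolynomial (Fin 3) k} {d : ℕ}
    (hf : IsWeightedHomogeneous (![0, 1, 1] : Fin 3 → ℕ) f d) :
    (polynomialEquiv k f).IsHomogeneous d := by
  rw [f.as_sum, map_sum]
  refine IsHomogeneous.sum _ _ _ fun m hm => ?_
  have hd : m 1 + m 2 = d := by
    have := hf (mem_support_iff.mp hm)
    rw [Finsupp.weight_apply, Finsupp.sum_fintype _ _ (by simp), Fin.sum_univ_three] at this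
    simpa using this
  have h1 : polynomialEquiv k (monomial m (coeff m f)) =
      C (Polynomial.C (coeff m f) * Polynomial.X ^ m 0) * (X 0 ^ m 1 * X 1 ^ m 2) := by
    rw [monomial_eq, Finsupp.prod_fintype _ _ (by simp), Fin.prod_univ_three, map_mul, map_mul,
      map_mul, map_pow, map_pow, map_pow, polynomialEquiv_X_zero,
      show (1 : Fin 3) = Fin.succ 0 from rfl, show (2 : Fin 3) = Fin.succ 1 from rfl,
      polynomialEquiv_X_succ, polynomialEquiv_X_succ, ← algebraMap_eq, AlgEquiv.commutes,
      C_mul, C_pow]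
    rw [mul_assoc, mul_assoc]
    rfl
  rw [h1, ← hd]
  refine IsHomogeneous.C_mul ?_ _
  exact (by simpa using (isHomogeneous_X _ (0 : Fin 2)).pow (m 1) : IsHomogeneous _ _).mul
    (by simpa using (isHomogeneous_X _ (1 : Fin 2)).pow (m 2))

end LinearGrowth

/-- The variables `t, x, y` are `X 0, X 1, X 2`, of degrees `0, 1, 1`. -/
theorem mainTheorem3 {k : Type*} [Field k] (p : ℕ) [Fact p.Prime] [CharP k p]
    (r : ℕ) (f : Fin r → MvPolynomial (Fin 3) k)
    (hf : ∀ i, ∃ d : ℕ, MvPolynomial.IsWeightedHomogeneous (![0, 1, 1] : Fin 3 → ℕ) (f i) d) :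
    HasLinearGrowthOfPrimaryDecompositions p
      (Ideal.span {Ideal.Quotient.mk (Ideal.span (Set.range f)) (MvPolynomial.X 1),
        Ideal.Quotient.mk (Ideal.span (Set.range f)) (MvPolynomial.X 2)}) := by
  let φ := (polynomialEquiv k).toRingEquiv
  let π := (Ideal.Quotient.mk (Ideal.span (Set.range f))).comp
    (φ.symm : MvPolynomial (Fin 2) (Polynomial k) →+* MvPolynomial (Fin 3) k)
  have hπ : Function.Surjective π := Ideal.Quotient.mk_surjective.comp φ.symm.surjective
  have hker : RingHom.ker π = Ideal.span (Set.range fun i => φ (f i)) := by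
    rw [← RingHom.comap_ker, Ideal.mk_ker]
    have h1 := Ideal.map_comap_of_equiv (I := Ideal.span (Set.range f)) φ
    refine h1.symm.trans ?_
    rw [Ideal.map_span, ← Set.range_comp]
    rfl
  have hX (i : Fin 2) : π (MvPolynomial.X i) =
      Ideal.Quotient.mk (Ideal.span (Set.range f)) (MvPolynomial.X i.succ) := by
    refine congrArg (Ideal.Quotient.mk _) (φ.symm_apply_eq.mpr ?_)
    exact (polynomialEquiv_X_succ k i).symm
  have h := hasLinearGrowthOfPrimaryDecompositions_of_surjective p
    (fun i => (hf i).imp fun d hd => IsWeightedHomogeneous.isHomogeneous_polynomialEquiv hd) π hπ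
    hker
  rw [hX, hX] at h
  exact h
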